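/- Let $p$ be a prime and let $a_2,a_3,b_2,b_3$ be nonzero elements of the field $\mathbb{Q}_p$ of $p$-adic numbers. For a $\mathbb{Q}_p$-valued random variable $\xi$ with distribution $\mu$, its characteristic function is $\hat\mu(\chi)=\int_{\mathbb{Q}_p}\chi(x)\,d\mu(x)$, where $\chi$ runs over the continuous characters $\chi:\mathbb{Q}_p\to\{z\in\mathbb{C}:|z|=1\}$ of the additive group of $\mathbb{Q}_p$. Let $\xi_1,\xi_2,\xi_3,\xi_4$ be independent $\mathbb{Q}_p$-valued random variables with nonvanishing characteristic functions, and put $$L_1=\xi_1+a_2\xi_2+a_3\xi_3,\qquad L_2=b_2\xi_2+b_3\xi_3+\xi_4.$$ Then the distribution of the random vector $(L_1,L_2)$ determines the distributions of $\xi_1$ and $\xi_4$ up to shift. That is, if $\eta_1,\eta_2,\eta_3,\eta_4$ are also independent $\mathbb{Q}_p$-valued random variables (possibly on another probability space) with nonvanishing characteristic functions, and if $(M_1,M_2)$, where $M_1=\eta_1+a_2\eta_2+a_3\eta_3$ and $M_2=b_2\eta_2+b_3\eta_3+\eta_4$, has the same distribution as $(L_1,L_2)$, then there are $c_1,c_4\in\mathbb{Q}_p$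 such that $\eta_1$ has the same distribution as $\xi_1+c_1$ and $\eta_4$ has the same distribution as $\xi_4+c_4$. -/

import Mathlib

open MeasureTheory ProbabilityTheory

/-- The characteristic function of a measure `μ` on a topological abelian group `G`, evaluated at
a character `χ` of `G` with values in the unit circle: `∫ (x, χ) dμ(x)`. The character group of `G`
consists of the continuous `χ`. -/
noncomputable def groupCharFun {G : Type*} [AddCommGroup G] [MeasurableSpace G]
    (μ : Measure G) (χ : AddChar G Circle) : ℂ :=
  ∫ x, (χ x : ℂ) ∂μ

/-- The characteristic function of `μ` vanishes nowhere on the character group of `G`. -/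
def NonvanishingCharFun {G : Type*} [AddCommGroup G] [TopologicalSpace G] [MeasurableSpace G]
    (μ : Measure G) : Prop :=
  ∀ χ : AddChar G Circle, Continuous χ → groupCharFun μ χ ≠ 0

/-- `ν` is a shift of `μ`, i.e. the convolution of `μ` with the point mass at some `c`. -/
def IsShiftOf {G : Type*} [AddCommGroup G] [MeasurableSpace G] (ν μ : Measure G) : Prop :=
  ∃ c : G, ν = μ.map (fun x => x + c)

/-! Fix a nontrivial continuous character `e` and let `f j` be the quotient of the characteristic
functions of `η j` and `ξ j` at `e (y * ·)`. Equality of the joint laws and independence give `f 0 u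
* f 1 (a₂u + b₂v) * f 2 (a₃u + b₃v) * f 3 v = 1`. Finite differences eliminate three of the factors,
so the remaining one is the exponential of a "quadratic polynomial"
(`third_difference_of_mul_eq_one`). There is no Gaussian part on `ℚ_[p]`: `p ^ n * u → 0`, while a
quadratic term scales by `p ^ (2 * n)`, an integer tending to infinity. Hence `f 0` and `f 3` are
characters (`map_add_eq_mul_of_third_difference`). By self-duality of `ℚ_[p]`
(`Padic.exists_eq_mulShift`) they are `y ↦ e (c * y)`, which is the effect of a shift by `c`. -/

open Filter Topology BoundedContinuousFunction

/-! ### Functional equation: finite differences and absence of a quadratic part. -/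

section Multiplicative

/-- If `f(u) g₁(a₁u + b₁v) g₂(a₂u + b₂v) g₃(v) = 1` identically, then the third multiplicative
difference of `f` at `0` is trivial. -/
theorem third_difference_of_mul_eq_one {K F : Type*} [Field K] [Field F] {f g₁ g₂ g₃ : K → F}
    {a₁ a₂ b₁ b₂ : K} (hb₁ : b₁ ≠ 0) (hb₂ : b₂ ≠ 0)
    (H : ∀ u v, f u * g₁ (a₁ * u + b₁ * v) * g₂ (a₂ * u + b₂ * v) * g₃ v = 1) (h k m : K) :
    f (h + k + m) * f h * f k * f m = f 0 * f (h + k) * f (h + m) * f (k + m) := by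
  -- The increments of `(u, v)` are `(h, 0)`, `(k, s)`, `(m, t)`. They fix the arguments of `g₃`,
  -- `g₂`, `g₁` respectively, so every `g` cancels in the alternating product over the cube.
  obtain ⟨s, hs⟩ : ∃ s, b₂ * s = -(a₂ * k) := ⟨-(a₂ * k) / b₂, by field_simp⟩
  obtain ⟨t, ht⟩ : ∃ t, b₁ * t = -(a₁ * m) := ⟨-(a₁ * m) / b₁, by field_simp⟩
  have e₀ := H 0 0
  have e₁ := H h 0
  have e₂ := H k s
  have e₃ := H m t
  have e₄ := H (h + k) s
  have e₅ := H (h + m) t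
  have e₆ := H (k + m) (s + t)
  have e₇ := H (h + k + m) (s + t)
  rw [show a₂ * k + b₂ * s = a₂ * 0 + b₂ * 0 by linear_combination hs] at e₂
  rw [show a₁ * m + b₁ * t = a₁ * 0 + b₁ * 0 by linear_combination ht] at e₃
  rw [show a₂ * (h + k) + b₂ * s = a₂ * h + b₂ * 0 by linear_combination hs] at e₄
  rw [show a₁ * (h + m) + b₁ * t = a₁ * h + b₁ * 0 by linear_combination ht] at e₅
  rw [show a₁ * (k + m) + b₁ * (s + t) = a₁ * k + b₁ * s by linear_combination ht,
    show a₂ * (k + m) + b₂ * (s + t) = a₂ * m + b₂ * t by linear_combination hs] at e₆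
  rw [show a₁ * (h + k + m) + b₁ * (s + t) = a₁ * (h + k) + b₁ * s by linear_combination ht,
    show a₂ * (h + k + m) + b₂ * (s + t) = a₂ * (h + m) + b₂ * t by linear_combination hs] at e₇
  have inv : ∀ {x y z w : F}, x * y * z * w = 1 → x = y⁻¹ * z⁻¹ * w⁻¹ := by
    intro x y z w hx
    rw [← mul_inv, ← mul_inv]
    exact eq_inv_of_mul_eq_one_left (by rw [← hx]; ring)
  rw [inv e₀, inv e₁, inv e₂, inv e₃, inv e₄, inv e₅, inv e₆, inv e₇]
  ring

/-- Excludes the quadratic part: it is applied to `r = |f u|²` with `p ^ 2` in place of `p`. -/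
theorem eq_one_of_tendsto_pow_pow {p : ℕ} (hp : 1 < p) {r : ℝ} (hr : 0 ≤ r)
    (h : Tendsto (fun n : ℕ => r ^ (p ^ n)) atTop (𝓝 1)) : r = 1 := by
  have hp' := tendsto_pow_atTop_atTop_of_one_lt hp
  rcases lt_trichotomy r 1 with h1 | h1 | h1
  · have := (tendsto_pow_atTop_nhds_zero_of_lt_one hr h1).comp hp'
    exact absurd (tendsto_nhds_unique h this) one_ne_zero
  · exact h1
  · have := (tendsto_pow_atTop_atTop_of_one_lt h1).comp hp'
    exact absurd h (not_tendsto_nhds_of_tendsto_atTop this _)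

open ComplexConjugate in
/-- A nowhere vanishing Hermitian function with trivial third multiplicative difference which
tends to `1` along `p ^ n * u` for all `u` is multiplicative. -/
theorem map_add_eq_mul_of_third_difference {K : Type*} [Field K] [CharZero K] {f : K → ℂ}
    {p : ℕ} (hp : 1 < p) (hf : ∀ u, f u ≠ 0) (h0 : f 0 = 1) (hconj : ∀ u, f (-u) = conj (f u))
    (hlim : ∀ u, Tendsto (fun n : ℕ => f ((p : K) ^ n * u)) atTop (𝓝 1))
    (H : ∀ h k m, f (h + k + m) * f h * f k * f m = f 0 * f (h + k) * f (h + m) * f (k + m))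
    (h k : K) : f (h + k) = f h * f k := by
  -- The polarization of `f`. The third-difference identity says exactly that it is
  -- bimultiplicative; the goal is `B = 1`.
  let B : K → K → ℂ := fun h k => f (h + k) / (f h * f k)
  have Bsymm : ∀ h k, B h k = B k h := fun h k => by simp only [B, add_comm, mul_comm]
  have Badd : ∀ h m k, B (h + m) k = B h k * B m k := by
    intro h m k
    have := hf h
    have := hf m
    have := hf k
    have := hf (h + m)
    simp only [B]
    field_simp
    linear_combination H h m k + f (h + m) * f (h + k) * f (m + k) * h0
  have Bzero : ∀ k, B 0 k = 1 := fun k => by simp [B, h0, hf]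
  have Bnat : ∀ (n : ℕ) h k, B (n * h) k = B h k ^ n := by
    intro n h k
    induction n with
    | zero => simp [Bzero]
    | succ n ih => rw [Nat.cast_succ, add_mul, one_mul, Badd, ih, pow_succ]
  have Bdiag : ∀ u, B u u = (Complex.normSq (f u) : ℂ) := by
    intro u
    have h1 : B u u * B (-u) u = 1 := by rw [← Badd, add_neg_cancel, Bzero]
    have h2 : B (-u) u = (f (-u) * f u)⁻¹ := by simp [B, h0]
    rw [h2, mul_inv_eq_one₀ (mul_ne_zero (hf _) (hf _)), hconj] at h1
    rw [h1, Complex.normSq_eq_conj_mul_self]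
  have hnorm : ∀ u, Complex.normSq (f u) = 1 := by
    intro u
    refine eq_one_of_tendsto_pow_pow (p := p ^ 2) (Nat.one_lt_pow two_ne_zero hp)
      (Complex.normSq_nonneg _) ?_
    have h1 : Tendsto (fun n : ℕ => Complex.normSq (f ((p : K) ^ n * u))) atTop (𝓝 1) := by
      have := (Complex.continuous_normSq.tendsto 1).comp (hlim u)
      rwa [map_one] at this
    refine h1.congr fun n => ?_
    have h2 : B ((p : K) ^ n * u) ((p : K) ^ n * u) = B u u ^ (p ^ 2) ^ n := by
      rw [← Nat.cast_pow, Bnat, Bsymm, Bnat, ← pow_mul]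
      ring_nf
    rw [Bdiag, Bdiag] at h2
    exact_mod_cast h2
  have Bone : ∀ u, B u u = 1 := fun u => by rw [Bdiag, hnorm, Complex.ofReal_one]
  -- Trivial on the diagonal, `B` is alternating; being also symmetric, it takes values `±1`.
  -- Halving `h` then removes the sign.
  have Bsq : ∀ h k, B h k * B h k = 1 := by
    intro h k
    have := Bone (h + k)
    rw [Badd, Bsymm h, Bsymm k, Badd, Badd, Bone, Bone, Bsymm k h] at this
    simpa using this
  have hB : B h k = 1 := by rw [← add_halves h, Badd, Bsq]
  exact (div_eq_one_iff_eq (mul_ne_zero (hf _) (hf _))).1 hB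

end Multiplicative

/-! ### Self-duality of `ℚ_[p]`. -/

section PadicCharacters

variable {p : ℕ} [Fact p.Prime]

/-- There is a continuous character of `ℚ_[p]` which is trivial on the unit ball but not at
`p⁻¹`. -/
theorem Padic.exists_addChar_circle :
    ∃ e : AddChar ℚ_[p] Circle, Continuous e ∧ (∀ x : ℚ_[p], ‖x‖ ≤ 1 → e x = 1) ∧
      e (p : ℚ_[p])⁻¹ ≠ 1 := by
  let S : AddSubgroup ℚ_[p] := (PadicInt.subring p).toAddSubgroup
  have hS : ∀ x : ℚ_[p], x ∈ S ↔ ‖x‖ ≤ 1 := fun x => Iff.rfl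
  have hp : (((p : ℚ_[p])⁻¹ : ℚ_[p]) : ℚ_[p] ⧸ S) ≠ 0 := by
    rw [Ne, QuotientAddGroup.eq_zero_iff, hS, norm_inv, Padic.norm_p, inv_inv, not_le]
    exact_mod_cast (Fact.out : p.Prime).one_lt
  -- Since `ℚ/ℤ` is divisible, its characters separate points of the discrete group `ℚ_[p] ⧸ S`.
  obtain ⟨c, hc⟩ := CharacterModule.exists_character_apply_ne_zero_of_ne_zero hp
  let c' : ℚ_[p] ⧸ S →+ AddCircle (1 : ℚ) := c
  let r : AddCircle (1 : ℚ) →+ AddCircle (1 : ℝ) :=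
    QuotientAddGroup.map _ _ (Rat.castHom ℝ).toAddMonoidHom (by
      rw [AddSubgroup.zmultiples_le]
      exact ⟨1, by simp⟩)
  have hr : Function.Injective r := by
    rw [injective_iff_map_eq_zero]
    intro x
    induction x using QuotientAddGroup.induction_on with
    | H q =>
      intro hq
      obtain ⟨n, hn⟩ := (AddCircle.coe_eq_zero_iff (1 : ℝ)).1 hq
      refine (AddCircle.coe_eq_zero_iff (1 : ℚ)).2 ⟨n, ?_⟩
      have hn' : (n : ℝ) = (q : ℝ) := by simpa using hn
      rw [zsmul_one]
      exact_mod_cast hn'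
  let e : AddChar ℚ_[p] Circle :=
    { toFun := fun x => AddCircle.toCircle (r (c' (x : ℚ_[p] ⧸ S)))
      map_zero_eq_one' := by simp
      map_add_eq_mul' := fun x y => by
        rw [QuotientAddGroup.mk_add, map_add, map_add, AddCircle.toCircle_add] }
  have hball : ∀ x : ℚ_[p], ‖x‖ ≤ 1 → e x = 1 := by
    intro x hx
    have : (x : ℚ_[p] ⧸ S) = 0 := (QuotientAddGroup.eq_zero_iff x).2 ((hS x).2 hx)
    change AddCircle.toCircle (r (c' (x : ℚ_[p] ⧸ S))) = 1
    simp [this]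
  refine ⟨e, ?_, hball, ?_⟩
  · rw [continuous_iff_continuousAt]
    intro x
    refine continuousAt_const.congr (f := fun _ => e x) ?_
    filter_upwards [Metric.ball_mem_nhds x one_pos] with y hy
    rw [← sub_add_cancel y x, AddChar.map_add_eq_mul, hball (y - x), one_mul]
    exact (mem_ball_iff_norm.1 hy).le
  · change AddCircle.toCircle (r (c' _)) ≠ 1
    rw [← AddCircle.toCircle_zero (T := 1), (AddCircle.injective_toCircle one_ne_zero).ne_iff,
      ← map_zero r, hr.ne_iff]
    exact hc

/-- A continuous character of `ℚ_[p]` is trivial on some ball. -/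
theorem Padic.exists_forall_norm_le_addChar_eq_one {φ : AddChar ℚ_[p] Circle}
    (hφ : Continuous φ) : ∃ N : ℕ, ∀ x : ℚ_[p], ‖x‖ ≤ 1 → φ ((p : ℚ_[p]) ^ N * x) = 1 := by
  have hU : ∀ᶠ x in 𝓝 (0 : ℚ_[p]), ‖(φ x : ℂ) - 1‖ < 1 / 2 := by
    have : Continuous fun x => ‖(φ x : ℂ) - 1‖ := by fun_prop
    refine this.continuousAt.eventually_lt continuousAt_const ?_
    simp
  obtain ⟨ε, hε, hU⟩ := Metric.eventually_nhds_iff_ball.1 hU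
  obtain ⟨N, hN⟩ := exists_pow_lt_of_lt_one hε
    (show ‖(p : ℚ_[p])‖ < 1 from Padic.norm_p_lt_one)
  refine ⟨N, fun x hx => ?_⟩
  -- The circle has no small subgroups: doubling stays in the small ball, yet near `1` squaring
  -- multiplies the distance to `1` by at least `3 / 2`.
  have hsmall : ∀ k : ℕ, ‖(φ (2 ^ k * ((p : ℚ_[p]) ^ N * x)) : ℂ) - 1‖ < 1 / 2 := by
    intro k
    apply hU
    rw [mem_ball_zero_iff, norm_mul, norm_mul, norm_pow, norm_pow]
    have h2 : ‖(2 : ℚ_[p])‖ ≤ 1 := by exact_mod_cast Padic.norm_int_le_one (p := p) 2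
    calc ‖(2 : ℚ_[p])‖ ^ k * (‖(p : ℚ_[p])‖ ^ N * ‖x‖) ≤ 1 * (‖(p : ℚ_[p])‖ ^ N * 1) := by
          gcongr
          exact pow_le_one₀ (norm_nonneg _) h2
      _ < ε := by simpa using hN
  have hgrow : ∀ k : ℕ, (3 / 2 : ℝ) ^ k * ‖(φ ((p : ℚ_[p]) ^ N * x) : ℂ) - 1‖ ≤
      ‖(φ (2 ^ k * ((p : ℚ_[p]) ^ N * x)) : ℂ) - 1‖ := by
    intro k
    induction k with
    | zero => simp
    | succ k ih =>
      have hz := hsmall k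
      have hdouble : (2 : ℚ_[p]) ^ (k + 1) * ((p : ℚ_[p]) ^ N * x) =
        2 ^ k * ((p : ℚ_[p]) ^ N * x) + 2 ^ k * ((p : ℚ_[p]) ^ N * x) := by ring
      rw [hdouble, AddChar.map_add_eq_mul, Circle.coe_mul]
      set z : ℂ := (φ (2 ^ k * ((p : ℚ_[p]) ^ N * x)) : ℂ)
      have h1 : (3 / 2 : ℝ) ≤ ‖z + 1‖ := by
        have h3 : ‖(2 : ℂ)‖ ≤ ‖z + 1‖ + ‖z - 1‖ := by
          rw [show (2 : ℂ) = (z + 1) - (z - 1) by ring]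
          exact norm_sub_le _ _
        rw [Complex.norm_ofNat] at h3
        linarith
      rw [show z * z - 1 = (z + 1) * (z - 1) by ring, norm_mul, pow_succ']
      calc _ = 3 / 2 * ((3 / 2 : ℝ) ^ k * ‖(φ ((p : ℚ_[p]) ^ N * x) : ℂ) - 1‖) := by ring
        _ ≤ _ := by gcongr
  by_contra hne
  have hpos : 0 < ‖(φ ((p : ℚ_[p]) ^ N * x) : ℂ) - 1‖ := by
    rw [norm_pos_iff, sub_ne_zero]
    exact fun h => hne (Circle.coe_eq_one.1 h)
  obtain ⟨k, hk⟩ := pow_unbounded_of_one_lt (1 / ‖(φ ((p : ℚ_[p]) ^ N * x) : ℂ) - 1‖)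
    (show (1 : ℝ) < 3 / 2 by norm_num)
  rw [div_lt_iff₀ hpos] at hk
  linarith [hgrow k, hsmall k]

/-- Two continuous characters of `ℚ_[p]` which agree at all `p ^ (-n)` are equal. -/
theorem Padic.addChar_eq_of_eq_inv_pow {φ ψ : AddChar ℚ_[p] Circle} (hφ : Continuous φ)
    (hψ : Continuous ψ) (h : ∀ n : ℕ, φ ((p : ℚ_[p])⁻¹ ^ (n + 1)) = ψ ((p : ℚ_[p])⁻¹ ^ (n + 1))) :
    φ = ψ := by
  have hp0 : (p : ℚ_[p]) ≠ 0 := by exact_mod_cast (Fact.out : p.Prime).ne_zero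
  -- `ℕ` is dense in `ℤ_[p]`, so `p ^ (-(n + 1))` topologically generates the ball that it spans;
  -- these balls exhaust `ℚ_[p]`.
  have hint : ∀ (n : ℕ) (z : ℤ_[p]),
      φ ((z : ℚ_[p]) * (p : ℚ_[p])⁻¹ ^ (n + 1)) = ψ ((z : ℚ_[p]) * (p : ℚ_[p])⁻¹ ^ (n + 1)) := by
    intro n
    refine congr_fun (PadicInt.denseRange_natCast.equalizer ?_ ?_ ?_)
    · fun_prop
    · fun_prop
    · funext k
      simp only [Function.comp, PadicInt.coe_natCast]
      rw [← nsmul_eq_mul, AddChar.map_nsmul_eq_pow, AddChar.map_nsmul_eq_pow, h]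
  ext x
  obtain ⟨n, hn⟩ : ∃ n : ℕ, ‖x * (p : ℚ_[p]) ^ (n + 1)‖ ≤ 1 := by
    have : Tendsto (fun n : ℕ => ‖x * (p : ℚ_[p]) ^ (n + 1)‖) atTop (𝓝 0) := by
      have := ((tendsto_pow_atTop_nhds_zero_of_norm_lt_one
        (Padic.norm_p_lt_one (p := p))).comp (tendsto_add_atTop_nat 1)).const_mul x
      simpa using this.norm
    exact (this.eventually (ge_mem_nhds one_pos)).exists
  have := hint n ⟨_, hn⟩
  rw [show x = x * (p : ℚ_[p]) ^ (n + 1) * (p : ℚ_[p])⁻¹ ^ (n + 1) by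
    rw [mul_assoc, ← mul_pow, mul_inv_cancel₀ hp0, one_pow, mul_one]]
  exact congrArg _ this

/-- Every continuous character of `ℚ_[p]` is `x ↦ e (c * x)` for a fixed continuous character `e`
which is trivial on the unit ball but not at `p⁻¹`. -/
theorem Padic.exists_eq_mulShift {e φ : AddChar ℚ_[p] Circle} (he : Continuous e)
    (heball : ∀ x : ℚ_[p], ‖x‖ ≤ 1 → e x = 1) (hep : e (p : ℚ_[p])⁻¹ ≠ 1) (hφ : Continuous φ) :
    ∃ c, φ = e.mulShift c := by
  have hp : p.Prime := Fact.out
  have hp0 : (p : ℚ_[p]) ≠ 0 := by exact_mod_cast hp.ne_zero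
  obtain ⟨N, hN⟩ := Padic.exists_forall_norm_le_addChar_eq_one hφ
  let ψ := φ.mulShift ((p : ℚ_[p]) ^ N)
  have hψ : Continuous ψ := by
    change Continuous fun x => φ ((p : ℚ_[p]) ^ N * x)
    fun_prop
  have hstep : ∀ (χ : AddChar ℚ_[p] Circle) (n : ℕ) (x : ℚ_[p]),
      χ (x * (p : ℚ_[p])⁻¹ ^ (n + 1)) ^ p = χ (x * (p : ℚ_[p])⁻¹ ^ n) := by
    intro χ n x
    rw [← AddChar.map_nsmul_eq_pow, nsmul_eq_mul]
    congr 1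
    rw [pow_succ]
    field_simp
  have hpow : ∀ (χ : AddChar ℚ_[p] Circle) (n m : ℕ),
      χ ((p : ℚ_[p])⁻¹ ^ (n + m)) ^ p ^ n = χ ((p : ℚ_[p])⁻¹ ^ m) := by
    intro χ n m
    rw [← AddChar.map_nsmul_eq_pow, nsmul_eq_mul, Nat.cast_pow, pow_add, ← mul_assoc, ← mul_pow,
      mul_inv_cancel₀ hp0, one_pow, one_mul]
  -- The multipliers that are correct at level `n`. These sets are nested, closed in the compact
  -- `ℤ_[p]` and nonempty, so some `c` works at all levels.
  let C : ℕ → Set ℤ_[p] := fun n =>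
    {c | e ((c : ℚ_[p]) * (p : ℚ_[p])⁻¹ ^ (n + 1)) = ψ ((p : ℚ_[p])⁻¹ ^ (n + 1))}
  have hCclosed : ∀ n, IsClosed (C n) := fun n =>
    isClosed_eq (by fun_prop) continuous_const
  have hCanti : ∀ n, C (n + 1) ⊆ C n := by
    intro n c hc
    have h1 := congrArg (· ^ p) (show _ = _ from hc)
    have h2 := hstep ψ (n + 1) 1
    simp only [one_mul] at h2
    simp only [hstep, h2] at h1
    exact h1
  have hCne : ∀ n, (C n).Nonempty := by
    intro n
    -- The order is exact because `e` is trivial at `1` but not at `p⁻¹`; hence every possible value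
    -- of `ψ` here is a power of this root of unity.
    have horder : orderOf (e ((p : ℚ_[p])⁻¹ ^ (n + 1))) = p ^ (n + 1) := by
      apply orderOf_eq_prime_pow
      · rwa [hpow e n 1, pow_one]
      · rw [hpow e (n + 1) 0, pow_zero]
        exact heball 1 (by simp)
    have hprim : IsPrimitiveRoot (e ((p : ℚ_[p])⁻¹ ^ (n + 1)) : ℂ) (p ^ (n + 1)) := by
      rw [← horder]
      exact (IsPrimitiveRoot.orderOf _).map_of_injective (f := Circle.coeHom)
        Circle.coe_injective
    have hroot : (ψ ((p : ℚ_[p])⁻¹ ^ (n + 1)) : ℂ) ^ p ^ (n + 1) = 1 := by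
      rw [← Circle.coe_pow, hpow ψ (n + 1) 0, pow_zero]
      exact congrArg _ (hN 1 (by simp))
    have : NeZero (p ^ (n + 1)) := ⟨pow_ne_zero _ hp.ne_zero⟩
    obtain ⟨i, -, hi⟩ := hprim.eq_pow_of_pow_eq_one hroot
    refine ⟨i, ?_⟩
    change e _ = _
    rw [PadicInt.coe_natCast, ← nsmul_eq_mul, AddChar.map_nsmul_eq_pow]
    exact Circle.coe_injective ((Circle.coe_pow _ _).trans hi)
  obtain ⟨c, hc⟩ := IsCompact.nonempty_iInter_of_sequence_nonempty_isCompact_isClosed C hCanti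
    hCne (hCclosed 0).isCompact hCclosed
  have key : ψ = e.mulShift (c : ℚ_[p]) := by
    refine Padic.addChar_eq_of_eq_inv_pow hψ ?_ fun n => ?_
    · change Continuous fun x => e (c * x)
      fun_prop
    · exact (show _ = _ from Set.mem_iInter.1 hc n).symm
  refine ⟨c * (p : ℚ_[p])⁻¹ ^ N, ?_⟩
  ext x
  have := DFunLike.congr_fun key ((p : ℚ_[p])⁻¹ ^ N * x)
  simp only [ψ, AddChar.mulShift_apply] at this
  rw [← mul_assoc, ← mul_pow, mul_inv_cancel₀ hp0, one_pow, one_mul, ← mul_assoc] at this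
  exact congrArg _ this

end PadicCharacters

/-! ### Characteristic functions: uniqueness, shifts, linear forms. -/

section CharFun

variable {K : Type*} [NormedField K] {e : AddChar K Circle}

theorem continuous_mulShift (he : Continuous e) (y : K) : Continuous (e.mulShift y) := by
  change Continuous fun x => e (y * x)
  fun_prop

theorem continuous_coe_mulShift (he : Continuous e) (y : K) :
    Continuous fun x => (e.mulShift y x : ℂ) := by
  have := continuous_mulShift he y
  fun_prop

/-- The bounded continuous function `x ↦ e (y * x)`. -/
noncomputable def mulShiftBCF (he : Continuous e) (y : K) : K →ᵇ ℂ :=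
  BoundedContinuousFunction.ofNormedAddCommGroup (fun x => (e.mulShift y x : ℂ))
    (continuous_coe_mulShift he y) 1 (fun _ => (Circle.norm_coe _).le)

theorem mulShiftBCF_apply (he : Continuous e) (y x : K) : mulShiftBCF he y x = e (y * x) := rfl

variable [MeasurableSpace K]

/-- A finite measure on `K` is determined by its characteristic function at the characters
`x ↦ e (y * x)`. -/
theorem MeasureTheory.Measure.ext_of_groupCharFun_mulShift [BorelSpace K] [CompleteSpace K]
    [SecondCountableTopology K] (he : Continuous e) (he1 : e ≠ 1) {μ ν : Measure K}
    [IsFiniteMeasure μ] [IsFiniteMeasure ν]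
    (h : ∀ y, groupCharFun μ (e.mulShift y) = groupCharFun ν (e.mulShift y)) : μ = ν := by
  let S : Submonoid (K →ᵇ ℂ) :=
    { carrier := Set.range (mulShiftBCF he)
      one_mem' := ⟨0, by ext x; simp [mulShiftBCF_apply]⟩
      mul_mem' := by
        rintro _ _ ⟨y, rfl⟩ ⟨z, rfl⟩
        exact ⟨y + z, by
          ext x; simp [mulShiftBCF_apply, add_mul, AddChar.map_add_eq_mul]⟩ }
  have hstar : star (S : Set (K →ᵇ ℂ)) ⊆ S := by
    rintro g ⟨y, hy⟩
    refine ⟨-y, ?_⟩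
    rw [← star_star g, ← hy]
    ext x
    simp [mulShiftBCF_apply, AddChar.map_neg_eq_inv, ← Circle.coe_inv_eq_conj]
  -- The functions `e (y * ·)` are closed under products and conjugation, so the star algebra they
  -- generate is just their span, where integrals agree by linearity.
  have hspan : ∀ g ∈ StarAlgebra.adjoin ℂ (S : Set (K →ᵇ ℂ)),
      g ∈ Submodule.span ℂ (S : Set (K →ᵇ ℂ)) := by
    intro g hg
    have hg' : g ∈ Algebra.adjoin ℂ ((S : Set (K →ᵇ ℂ)) ∪ star (S : Set (K →ᵇ ℂ))) := hg
    rw [Set.union_eq_self_of_subset_right hstar] at hg'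
    rwa [← Subalgebra.mem_toSubmodule, Algebra.adjoin_eq_span, Submonoid.closure_eq] at hg'
  refine ext_of_forall_mem_subalgebra_integral_eq_of_pseudoEMetric_complete_countable
    (𝕜 := ℂ) (A := StarAlgebra.adjoin ℂ (S : Set (K →ᵇ ℂ))) ?_ ?_
  · intro x x' hxx'
    obtain ⟨a, ha⟩ := DFunLike.ne_iff.mp he1
    have hsub : x - x' ≠ 0 := sub_ne_zero.2 hxx'
    -- This multiplier sends `x - x'` to `a`, where `e a ≠ 1`, so the two points are separated.
    refine ⟨_, ⟨_, ⟨mulShiftBCF he (a / (x - x')),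
      StarAlgebra.subset_adjoin ℂ _ ⟨_, rfl⟩, rfl⟩, rfl⟩, fun hx => ha ?_⟩
    have hx' : e (a / (x - x') * x) = e (a / (x - x') * x') := Circle.coe_injective hx
    have : a = a / (x - x') * x - a / (x - x') * x' := by field_simp
    rw [this, AddChar.map_sub_eq_div, hx', div_self']
    rfl
  · intro g hg
    replace hg := hspan g hg
    induction hg using Submodule.span_induction with
    | mem g hg =>
      obtain ⟨y, rfl⟩ := hg
      exact h y
    | zero => simp
    | add g g' _ _ hg hg' =>
      simp only [BoundedContinuousFunction.coe_add, Pi.add_apply]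
      rw [integral_add (g.integrable μ) (g'.integrable μ),
        integral_add (g.integrable ν) (g'.integrable ν)]
      exact congrArg₂ (· + ·) hg hg'
    | smul c g _ hg =>
      simp only [BoundedContinuousFunction.coe_smul]
      rw [integral_smul, integral_smul]
      exact congrArg (c • ·) hg

theorem continuous_groupCharFun_mulShift [BorelSpace K] [SecondCountableTopology K]
    (he : Continuous e) (μ : Measure K) [IsFiniteMeasure μ] :
    Continuous fun y => groupCharFun μ (e.mulShift y) := by
  refine continuous_of_dominated (bound := fun _ => 1) (fun y => ?_) (fun y => ?_)
    (integrable_const 1) ?_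
  · exact (continuous_coe_mulShift he y).aestronglyMeasurable
  · exact ae_of_all _ fun x => (Circle.norm_coe _).le
  · refine ae_of_all _ fun x => ?_
    change Continuous fun y => (e (y * x) : ℂ)
    fun_prop

open ComplexConjugate in
theorem groupCharFun_mulShift_neg (μ : Measure K) (y : K) :
    groupCharFun μ (e.mulShift (-y)) = conj (groupCharFun μ (e.mulShift y)) := by
  rw [groupCharFun, groupCharFun, ← integral_conj]
  simp [AddChar.map_neg_eq_inv, ← Circle.coe_inv_eq_conj]

theorem groupCharFun_mulShift_zero (μ : Measure K) [IsProbabilityMeasure μ] :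
    groupCharFun μ (e.mulShift 0) = 1 := by
  simp [groupCharFun]

theorem groupCharFun_map_add_const [BorelSpace K] [SecondCountableTopology K]
    (he : Continuous e) (μ : Measure K) (c y : K) :
    groupCharFun (μ.map (fun x => x + c)) (e.mulShift y) =
      e (c * y) * groupCharFun μ (e.mulShift y) := by
  rw [groupCharFun, groupCharFun, integral_map (by fun_prop)
    (continuous_coe_mulShift he y).aestronglyMeasurable,
    ← integral_const_mul]
  congr 1
  ext x
  rw [AddChar.mulShift_apply, AddChar.mulShift_apply, mul_add, AddChar.map_add_eq_mul,
    Circle.coe_mul, mul_comm, mul_comm y c]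

/-- The joint characteristic function of two linear forms in independent random variables. -/
theorem integral_linearForms [BorelSpace K] [SecondCountableTopology K] (he : Continuous e)
    {Ω : Type*} [MeasurableSpace Ω] {P : Measure Ω} [IsProbabilityMeasure P]
    {a₂ a₃ b₂ b₃ : K} {ξ : Fin 4 → Ω → K} (hξ : ∀ j, Measurable (ξ j)) (hind : iIndepFun ξ P)
    (u v : K) :
    ∫ z : K × K, (e (u * z.1 + v * z.2) : ℂ)
      ∂(P.map (fun ω => (ξ 0 ω + a₂ * ξ 1 ω + a₃ * ξ 2 ω, b₂ * ξ 1 ω + b₃ * ξ 2 ω + ξ 3 ω))) =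
    groupCharFun (P.map (ξ 0)) (e.mulShift u) *
      groupCharFun (P.map (ξ 1)) (e.mulShift (a₂ * u + b₂ * v)) *
      groupCharFun (P.map (ξ 2)) (e.mulShift (a₃ * u + b₃ * v)) *
      groupCharFun (P.map (ξ 3)) (e.mulShift v) := by
  have hcont : Continuous fun z : K × K => (e (u * z.1 + v * z.2) : ℂ) := by fun_prop
  have hmeas : ∀ y : K, Continuous fun x => (e.mulShift y x : ℂ) := fun y =>
    continuous_coe_mulShift he y
  have h0 := hξ 0
  have h1 := hξ 1
  have h2 := hξ 2
  have h3 := hξ 3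
  rw [integral_map (by fun_prop) hcont.aestronglyMeasurable]
  have key := hind.integral_fun_prod_comp (𝕜 := ℂ)
    (f := fun j x => (e.mulShift (![u, a₂ * u + b₂ * v, a₃ * u + b₃ * v, v] j) x : ℂ))
    (fun j => (hξ j).aemeasurable) (fun j => (hmeas _).aestronglyMeasurable)
  have hchar : ∀ j y, groupCharFun (P.map (ξ j)) (e.mulShift y) =
      ∫ ω, (e.mulShift y (ξ j ω) : ℂ) ∂P := fun j y =>
    integral_map (hξ j).aemeasurable (hmeas y).aestronglyMeasurable
  simp only [hchar]
  simp only [Fin.prod_univ_four] at key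
  refine Eq.trans ?_ key
  congr 1
  ext ω
  simp only [← Circle.coe_mul, AddChar.mulShift_apply, ← AddChar.map_add_eq_mul]
  congr 2
  simp
  ring

end CharFun

/-! ### From the functional equation to shifts. -/

section Padic

variable {p : ℕ} [Fact p.Prime] [MeasurableSpace ℚ_[p]] [BorelSpace ℚ_[p]]

/-- If the ratio of the nonvanishing characteristic functions of `ν` and `μ` has trivial third
multiplicative difference, then `ν` is a shift of `μ`. -/
theorem isShiftOf_of_third_difference {e : AddChar ℚ_[p] Circle} (he : Continuous e)
    (heball : ∀ x : ℚ_[p], ‖x‖ ≤ 1 → e x = 1) (hep : e (p : ℚ_[p])⁻¹ ≠ 1)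
    {μ ν : Measure ℚ_[p]} [IsProbabilityMeasure μ] [IsProbabilityMeasure ν]
    (hμ : NonvanishingCharFun μ) (hν : NonvanishingCharFun ν) {f : ℚ_[p] → ℂ}
    (hf : ∀ y, f y = groupCharFun ν (e.mulShift y) / groupCharFun μ (e.mulShift y))
    (H : ∀ h k m, f (h + k + m) * f h * f k * f m = f 0 * f (h + k) * f (h + m) * f (k + m)) :
    IsShiftOf ν μ := by
  have hμ' : ∀ y, groupCharFun μ (e.mulShift y) ≠ 0 := fun y => hμ _ (continuous_mulShift he y)
  have hν' : ∀ y, groupCharFun ν (e.mulShift y) ≠ 0 := fun y => hν _ (continuous_mulShift he y)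
  have hne : ∀ y, f y ≠ 0 := fun y => by rw [hf]; exact div_ne_zero (hν' y) (hμ' y)
  have h0 : f 0 = 1 := by
    rw [hf, groupCharFun_mulShift_zero, groupCharFun_mulShift_zero, div_one]
  have hconj : ∀ y, f (-y) = starRingEnd ℂ (f y) := fun y => by
    rw [hf, hf, groupCharFun_mulShift_neg, groupCharFun_mulShift_neg, map_div₀]
  have hfc : Continuous f := by
    rw [funext hf]
    exact (continuous_groupCharFun_mulShift he ν).div (continuous_groupCharFun_mulShift he μ) hμ'
  have hlim : ∀ u, Tendsto (fun n : ℕ => f ((p : ℚ_[p]) ^ n * u)) atTop (𝓝 1) := by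
    intro u
    have h1 : Tendsto (fun n : ℕ => (p : ℚ_[p]) ^ n * u) atTop (𝓝 0) := by
      simpa using (tendsto_pow_atTop_nhds_zero_of_norm_lt_one
        (Padic.norm_p_lt_one (p := p))).mul_const u
    simpa only [h0, Function.comp_def] using (hfc.tendsto 0).comp h1
  have hmul := map_add_eq_mul_of_third_difference (Fact.out : p.Prime).one_lt hne h0 hconj hlim H
  have hnorm : ∀ y, f y ∈ Submonoid.unitSphere ℂ := by
    intro y
    have h1 : f y * starRingEnd ℂ (f y) = 1 := by rw [← hconj, ← hmul, add_neg_cancel, h0]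
    rw [Complex.mul_conj'] at h1
    have h2 : ‖f y‖ ^ 2 = 1 := by exact_mod_cast h1
    exact mem_sphere_zero_iff_norm.2
      ((pow_eq_one_iff_of_nonneg (norm_nonneg _) two_ne_zero).1 h2)
  let φ : AddChar ℚ_[p] Circle :=
    { toFun := fun y => ⟨f y, hnorm y⟩
      map_zero_eq_one' := Circle.ext h0
      map_add_eq_mul' := fun x y => Circle.ext (hmul x y) }
  have hφ : Continuous φ := Continuous.subtype_mk hfc _
  obtain ⟨c, hc⟩ := Padic.exists_eq_mulShift he heball hep hφ
  have he1 : e ≠ 1 := fun h => hep (by rw [h, AddChar.one_apply])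
  have : IsProbabilityMeasure (μ.map (fun x => x + c)) :=
    Measure.isProbabilityMeasure_map (by fun_prop)
  refine ⟨c, Measure.ext_of_groupCharFun_mulShift he he1 fun y => ?_⟩
  have hfy : f y = e (c * y) := congrArg (fun χ : AddChar ℚ_[p] Circle => (χ y : ℂ)) hc
  rw [groupCharFun_map_add_const he, ← hfy, hf, div_mul_cancel₀ _ (hμ' y)]

end Padic

/-- The random variables `ξ₁, ξ₂, ξ₃, ξ₄` are `ξ 0, ξ 1, ξ 2, ξ 3`, and likewise for `η`, any other
such quadruple (possibly on another probability space) giving the same joint law of the two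
linear forms. -/
theorem corollary3p3 {p : ℕ} [Fact p.Prime] [MeasurableSpace ℚ_[p]] [BorelSpace ℚ_[p]]
    {Ω Ω' : Type*} [MeasurableSpace Ω] [MeasurableSpace Ω']
    (P : Measure Ω) [IsProbabilityMeasure P] (P' : Measure Ω') [IsProbabilityMeasure P']
    (a₂ a₃ b₂ b₃ : ℚ_[p]) (ha₂ : a₂ ≠ 0) (ha₃ : a₃ ≠ 0) (hb₂ : b₂ ≠ 0) (hb₃ : b₃ ≠ 0)
    (ξ : Fin 4 → Ω → ℚ_[p]) (hξ : ∀ j, Measurable (ξ j)) (hξ_indep : iIndepFun ξ P)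
    (hξ_char : ∀ j, NonvanishingCharFun (P.map (ξ j)))
    (η : Fin 4 → Ω' → ℚ_[p]) (hη : ∀ j, Measurable (η j)) (hη_indep : iIndepFun η P')
    (hη_char : ∀ j, NonvanishingCharFun (P'.map (η j)))
    (hlaw :
      P.map (fun ω => (ξ 0 ω + a₂ * ξ 1 ω + a₃ * ξ 2 ω, b₂ * ξ 1 ω + b₃ * ξ 2 ω + ξ 3 ω)) =
      P'.map (fun ω => (η 0 ω + a₂ * η 1 ω + a₃ * η 2 ω, b₂ * η 1 ω + b₃ * η 2 ω + η 3 ω))) :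
    IsShiftOf (P'.map (η 0)) (P.map (ξ 0)) ∧ IsShiftOf (P'.map (η 3)) (P.map (ξ 3)) := by
  obtain ⟨e, he, heball, hep⟩ := Padic.exists_addChar_circle (p := p)
  let f : Fin 4 → ℚ_[p] → ℂ := fun j y =>
    groupCharFun (P'.map (η j)) (e.mulShift y) / groupCharFun (P.map (ξ j)) (e.mulShift y)
  have hξ' : ∀ j y, groupCharFun (P.map (ξ j)) (e.mulShift y) ≠ 0 := fun j y =>
    hξ_char j _ (continuous_mulShift he y)
  have hprod : ∀ u v, f 0 u * f 1 (a₂ * u + b₂ * v) * f 2 (a₃ * u + b₃ * v) * f 3 v = 1 := by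
    intro u v
    have h1 := integral_linearForms he (a₂ := a₂) (a₃ := a₃) (b₂ := b₂) (b₃ := b₃)
      hξ hξ_indep u v
    rw [hlaw, integral_linearForms he hη hη_indep] at h1
    simp only [f]
    rw [div_mul_div_comm, div_mul_div_comm, div_mul_div_comm, h1]
    exact div_self (mul_ne_zero (mul_ne_zero (mul_ne_zero (hξ' _ _) (hξ' _ _)) (hξ' _ _))
      (hξ' _ _))
  -- Exchanging `u` and `v` makes `f 3` the surviving factor; this is where `a₂` and `a₃` must be
  -- nonzero.
  have hprod' : ∀ v u, f 3 v * f 1 (b₂ * v + a₂ * u) * f 2 (b₃ * v + a₃ * u) * f 0 u = 1 := by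
    intro v u
    rw [← hprod u v, add_comm (b₂ * v), add_comm (b₃ * v)]
    ring
  have hPξ : ∀ j, IsProbabilityMeasure (P.map (ξ j)) := fun j =>
    Measure.isProbabilityMeasure_map (hξ j).aemeasurable
  have hPη : ∀ j, IsProbabilityMeasure (P'.map (η j)) := fun j =>
    Measure.isProbabilityMeasure_map (hη j).aemeasurable
  exact ⟨isShiftOf_of_third_difference he heball hep (hξ_char 0) (hη_char 0) (f := f 0)
      (fun _ => rfl)
      (third_difference_of_mul_eq_one (g₁ := f 1) (g₂ := f 2) (g₃ := f 3) hb₂ hb₃ hprod),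
    isShiftOf_of_third_difference he heball hep (hξ_char 3) (hη_char 3) (f := f 3)
      (fun _ => rfl)
      (third_difference_of_mul_eq_one (g₁ := f 1) (g₂ := f 2) (g₃ := f 0) ha₂ ha₃ hprod')⟩
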